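/- Let $R$ be an integral domain. A finitely generated ideal $J$ of $R$ is called a GV-ideal if the natural map $R\to \operatorname{Hom}_R(J,R)$, $r\mapsto (x\mapsto rx)$, is an isomorphism. An $R$-module $M$ is GV-torsion-free if no nonzero element of $M$ is annihilated by a GV-ideal; a GV-torsion-free module $M$ is a $w$-module if $\operatorname{Ext}^1_R(R/J,M)=0$ for every GV-ideal $J$. An ideal that is a $w$-module is called a $w$-ideal, and $R$ is a DW-domain if every ideal of $R$ is a $w$-ideal. A maximal $w$-ideal is an ideal that is maximal among the proper $w$-ideals of $R$ (such an ideal is prime), and a sequence $0\to A\to B\to C\to 0$ of $R$-modules is $w$-exact if $0\to A_{\mathfrak p}\to B_{\mathfrak p}\to C_{\mathfrak p}\to 0$ is exact for every maximal $w$-ideal $\mathfrak p$. A submodule $A$ of an $R$-module $B$ is $w$-pure if $0\to A\to B\to B/A\to 0$ is $w$-exact and $0\to A\otimes_R M\to B\otimes_R M\to (B/A)\otimes_R M\to 0$ is $w$-exact for every $R$-module $M$. An $R$-module $A$ is absolutely $w$-pure if it is a $w$-pure submodule of every $R$-module containing it as a submodule. An $R$-module $M$ is $w$-FP-projective if $\operatorname{Ext}^1_R(M,A)=0$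 for every absolutely $w$-pure $R$-module $A$. Finally, $R$ is coherent if every finitely generated ideal of $R$ is finitely presented. Then $R$ is a coherent DW-domain if and only if every finitely generated torsion-free $R$-module is $w$-FP-projective. -/

import Mathlib

universe u

namespace WFP

open CategoryTheory CategoryTheory.Abelian

section Defs

variable (R : Type u) [CommRing R]

/-- The statement `Ext¹_R(M, N) = 0`. -/
def ExtOneVanishes (M N : Type u) [AddCommGroup M] [Module R M]
    [AddCommGroup N] [Module R N] : Prop :=
  Subsingleton (Ext (ModuleCat.of R M) (ModuleCat.of R N) 1)

variable {R} in
/-- `J` is a Glaz-Vasconcelos ideal: it is finitely generated and the natural homomorphism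
`R → Hom_R(J, R)`, `r ↦ (x ↦ r * x)`, is an isomorphism. -/
def IsGVIdeal (J : Ideal R) : Prop :=
  J.FG ∧ Function.Bijective (LinearMap.toSpanSingleton R (J →ₗ[R] R) J.subtype)

/-- `tor_GV(M) = 0`. -/
def IsGVTorsionFree (M : Type u) [AddCommGroup M] [Module R M] : Prop :=
  ∀ x : M, (∃ J : Ideal R, IsGVIdeal J ∧ ∀ a ∈ J, a • x = 0) → x = 0

/-- `M` is a `w`-module: it is GV-torsion-free and `Ext¹_R(R/J, M) = 0` for every GV-ideal `J`. -/
def IsWModule (M : Type u) [AddCommGroup M] [Module R M] : Prop :=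
  IsGVTorsionFree R M ∧ ∀ J : Ideal R, IsGVIdeal J → ExtOneVanishes R (R ⧸ J) M

/-- `R` is a DW-ring: every ideal of `R` is a `w`-ideal. -/
def IsDWRing : Prop := ∀ I : Ideal R, IsWModule R I

/-- `R` is coherent: every finitely generated ideal of `R` is finitely presented. -/
def IsCoherent : Prop := ∀ I : Ideal R, I.FG → Module.FinitePresentation R I

variable {R} in
/-- `p` is a maximal `w`-ideal: it is maximal among the proper `w`-ideals of `R`. -/
def IsMaximalWIdeal (p : Ideal R) : Prop :=
  Maximal (fun I : Ideal R => I ≠ ⊤ ∧ IsWModule R I) p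

end Defs

section Prime

variable {R : Type u} [CommRing R]

theorem IsGVIdeal.eq_zero {J : Ideal R} (hJ : IsGVIdeal J) {x : R}
    (hx : ∀ a ∈ J, a * x = 0) : x = 0 := by
  apply hJ.2.1
  ext a
  simpa [mul_comm] using hx a a.2

theorem isGVTorsionFree_ideal (I : Ideal R) : IsGVTorsionFree R I := by
  rintro x ⟨J, hJ, hx⟩
  ext
  exact hJ.eq_zero fun a ha => by simpa using congrArg Subtype.val (hx a ha)

/-- `Ext¹_R(R/J, M) = 0` if and only if every homomorphism `J → M` extends to `R`. -/
theorem extOneVanishes_quotient_iff (J : Ideal R) (M : Type u) [AddCommGroup M] [Module R M] :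
    ExtOneVanishes R (R ⧸ J) M ↔ ∀ f : J →ₗ[R] M, ∃ m : M, ∀ a : J, f a = (a : R) • m := by
  let S : ShortComplex (ModuleCat.{u} R) :=
    { X₁ := ModuleCat.of R J
      X₂ := ModuleCat.of R R
      X₃ := ModuleCat.of R (R ⧸ J)
      f := ModuleCat.ofHom J.subtype
      g := ModuleCat.ofHom J.mkQ
      zero := by ext x; exact Ideal.Quotient.eq_zero_iff_mem.2 x.2 }
  have hS : S.ShortExact := ModuleCat.shortComplex_shortExact S
    (LinearMap.exact_subtype_mkQ J) J.injective_subtype J.mkQ_surjective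
  have : Projective S.X₂ := inferInstanceAs (Projective (ModuleCat.of R R))
  constructor
  · intro h f
    obtain ⟨x₂, hx₂⟩ := Ext.contravariant_sequence_exact₁ hS (ModuleCat.of R M)
      (Ext.mk₀ (X := S.X₁) (ModuleCat.ofHom f)) (add_zero 1)
      ((show Subsingleton (Ext S.X₃ (ModuleCat.of R M) 1) from h).elim _ _)
    obtain ⟨g, rfl⟩ := (Ext.mk₀_bijective _ _).2 x₂
    rw [Ext.mk₀_comp_mk₀] at hx₂
    have hg := (Ext.mk₀_bijective _ _).1 hx₂
    refine ⟨g.hom (1 : R), fun a => ?_⟩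
    have h1 := congrArg (fun t => t.hom a) hg
    have h2 : g.hom (a : R) = f a := h1
    rw [← h2, ← map_smul]
    congr 1
    exact (mul_one (a : R)).symm
  · intro h
    refine subsingleton_of_forall_eq 0 fun e => ?_
    obtain ⟨x₁, hx₁⟩ := Ext.contravariant_sequence_exact₃ hS (ModuleCat.of R M) e
      (Ext.eq_zero_of_projective _) (add_zero 1)
    obtain ⟨f, rfl⟩ := (Ext.mk₀_bijective _ _).2 x₁
    obtain ⟨m, hm⟩ := h f.hom
    have hf : f = S.f ≫ ModuleCat.ofHom (LinearMap.toSpanSingleton R M m) := by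
      ext a
      exact hm a
    rw [← hx₁, hf, ← Ext.mk₀_comp_mk₀, ← Ext.comp_assoc_of_second_deg_zero]
    simp

theorem isWModule_ideal_iff (I : Ideal R) :
    IsWModule R I ↔ ∀ J : Ideal R, IsGVIdeal J → ∀ x : R, (∀ a ∈ J, a * x ∈ I) → x ∈ I := by
  constructor
  · rintro ⟨-, h⟩ J hJ x hx
    obtain ⟨m, hm⟩ := (extOneVanishes_quotient_iff J I).1 (h J hJ)
      ((LinearMap.toSpanSingleton R R x ∘ₗ J.subtype).codRestrict I fun a => by
        simpa using hx a a.2)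
    have h0 : x - m = 0 := hJ.eq_zero fun a ha => by
      have := congrArg Subtype.val (hm ⟨a, ha⟩)
      simp at this
      rw [mul_sub, this, sub_self]
    rw [sub_eq_zero.1 h0]
    exact m.2
  · refine fun h => ⟨isGVTorsionFree_ideal I, fun J hJ => ?_⟩
    rw [extOneVanishes_quotient_iff]
    intro f
    obtain ⟨x, hx⟩ := hJ.2.2 (I.subtype ∘ₗ f)
    have hx' : ∀ a : J, ((f a : I) : R) = a * x := fun a => by
      have := LinearMap.congr_fun hx a
      simpa [mul_comm] using this.symm
    refine ⟨⟨x, h J hJ x fun a ha => ?_⟩, fun a => Subtype.ext (hx' a)⟩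
    rw [← hx' ⟨a, ha⟩]
    exact (f ⟨a, ha⟩).2

/-- Every maximal `w`-ideal is prime. -/
theorem IsMaximalWIdeal.isPrime {p : Ideal R} (hp : IsMaximalWIdeal p) : p.IsPrime := by
  refine ⟨hp.prop.1, fun {a b} hab => or_iff_not_imp_left.2 fun ha => ?_⟩
  let q : Ideal R := Submodule.comap (LinearMap.toSpanSingleton R R a) p
  have hq : ∀ x, x ∈ q ↔ x * a ∈ p := fun x => by simp [q]
  have hpq : p ≤ q := fun x hx => (hq x).2 (p.mul_mem_right a hx)
  have hqw : IsWModule R q := by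
    rw [isWModule_ideal_iff]
    intro J hJ x hx
    rw [hq]
    refine (isWModule_ideal_iff p).1 hp.prop.2 J hJ _ fun c hc => ?_
    rw [← mul_assoc]
    exact (hq _).1 (hx c hc)
  have hqt : q ≠ ⊤ := fun h => ha (by
    have : (1 : R) ∈ q := h ▸ Submodule.mem_top
    simpa using (hq 1).1 this)
  exact hp.le_of_ge ⟨hqt, hqw⟩ hpq ((hq b).2 (by rwa [mul_comm]))

end Prime

section Pure

variable {R : Type u} [CommRing R]

/-- The sequence `0 → A → B → C → 0` given by `f` and `g` is `w`-exact: it is exact after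
localization at every maximal `w`-ideal `p`. The binder `[p.IsPrime]` only provides the
localization: by `IsMaximalWIdeal.isPrime` it excludes no maximal `w`-ideal. -/
def IsWExact {A B C : Type u} [AddCommGroup A] [Module R A] [AddCommGroup B] [Module R B]
    [AddCommGroup C] [Module R C] (f : A →ₗ[R] B) (g : B →ₗ[R] C) : Prop :=
  ∀ (p : Ideal R) [p.IsPrime], IsMaximalWIdeal p →
    Function.Injective (LocalizedModule.map p.primeCompl f) ∧
    Function.Exact (LocalizedModule.map p.primeCompl f) (LocalizedModule.map p.primeCompl g) ∧
    Function.Surjective (LocalizedModule.map p.primeCompl g)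

/-- The sequence `0 → A → B → C → 0` given by `f` and `g` is `w`-pure exact. -/
def IsWPureExact {A B C : Type u} [AddCommGroup A] [Module R A] [AddCommGroup B] [Module R B]
    [AddCommGroup C] [Module R C] (f : A →ₗ[R] B) (g : B →ₗ[R] C) : Prop :=
  IsWExact f g ∧ ∀ (M : Type u) [AddCommGroup M] [Module R M],
    IsWExact (f.rTensor M) (g.rTensor M)

/-- `A` is a `w`-pure submodule of `B`. -/
def IsWPureSubmodule {B : Type u} [AddCommGroup B] [Module R B] (A : Submodule R B) : Prop :=
  IsWPureExact A.subtype A.mkQ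

variable (R)

/-- `A` is absolutely `w`-pure: it is a `w`-pure submodule of every module that contains it,
that is, its image under every injective homomorphism `A → B` is a `w`-pure submodule of `B`. -/
def IsAbsolutelyWPure (A : Type u) [AddCommGroup A] [Module R A] : Prop :=
  ∀ (B : Type u) [AddCommGroup B] [Module R B] (i : A →ₗ[R] B),
    Function.Injective i → IsWPureSubmodule (LinearMap.range i)

/-- `M` is `w`-FP-projective: `Ext¹_R(M, A) = 0` for every absolutely `w`-pure module `A`. -/
def IsWFPProjective (M : Type u) [AddCommGroup M] [Module R M] : Prop :=
  ∀ (A : Type u) [AddCommGroup A] [Module R A], IsAbsolutelyWPure R A → ExtOneVanishes R M A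

end Pure

end WFP

/-!
Over a DW-ring the maximal `w`-ideals are the maximal ideals, so absolutely `w`-pure modules are
absolutely pure and every finitely presented module is `w`-FP-projective. A finitely generated
torsion-free module over a domain embeds into a finite free module, hence is finitely presented
when the domain is coherent.

Conversely, a finitely generated `w`-FP-projective module is already finitely presented (Enochs).
A GV-ideal `J` is contained in no maximal `w`-ideal, so every module killed by `J` is absolutely
`w`-pure. If `0 → K → F → J → 0` is a finite free presentation of a `w`-FP-projective GV-ideal,
then `K → K / J K` extends to `F`, and the Cayley-Hamilton theorem turns such an extension into a
map `s : J → F` that composes with `F → J` to multiplication by some `r ∈ 1 + J`. Every linear map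
from `J` to a finite free module is multiplication by a vector, which forces `r ∈ J`; so `J = R`.
-/

namespace WFP

open CategoryTheory CategoryTheory.Abelian TensorProduct

section ExtOne

theorem subsingleton_ext_one_iff_of_shortExact {C : Type*} [Category* C] [Abelian C] [HasExt C]
    {S : ShortComplex C} (hS : S.ShortExact) [Projective S.X₂] (Y : C) :
    Subsingleton (Ext S.X₃ Y 1) ↔ ∀ f : S.X₁ ⟶ Y, ∃ h : S.X₂ ⟶ Y, S.f ≫ h = f := by
  constructor
  · intro _ f
    obtain ⟨x, hx⟩ := Ext.contravariant_sequence_exact₁ hS Y (Ext.mk₀ f) (add_zero 1)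
      (Subsingleton.elim _ _)
    obtain ⟨h, rfl⟩ := (Ext.mk₀_bijective _ _).2 x
    rw [Ext.mk₀_comp_mk₀] at hx
    exact ⟨h, (Ext.mk₀_bijective _ _).1 hx⟩
  · refine fun hext => subsingleton_of_forall_eq 0 fun e => ?_
    obtain ⟨x, rfl⟩ := Ext.contravariant_sequence_exact₃ hS Y e
      (Ext.eq_zero_of_projective _) (add_zero 1)
    obtain ⟨f, rfl⟩ := (Ext.mk₀_bijective _ _).2 x
    obtain ⟨h, rfl⟩ := hext f
    rw [← Ext.mk₀_comp_mk₀, hS.extClass_comp_assoc]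

variable {R : Type u} [CommRing R]

theorem extOneVanishes_iff_forall_exists_comp_eq {K P M : Type u} [AddCommGroup K] [Module R K]
    [AddCommGroup P] [Module R P] [Module.Projective R P] [AddCommGroup M] [Module R M]
    {i : K →ₗ[R] P} {g : P →ₗ[R] M} (hi : Function.Injective i) (hig : Function.Exact i g)
    (hg : Function.Surjective g) (N : Type u) [AddCommGroup N] [Module R N] :
    ExtOneVanishes R M N ↔ ∀ f : K →ₗ[R] N, ∃ h : P →ₗ[R] N, h ∘ₗ i = f := by
  let S : ShortComplex (ModuleCat.{u} R) :=
    .mk (ModuleCat.ofHom i) (ModuleCat.ofHom g) (by ext x; exact hig.apply_apply_eq_zero x)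
  have hS : S.ShortExact := ModuleCat.shortComplex_shortExact S hig hi hg
  have : Projective S.X₂ := (IsProjective.iff_projective P).1 inferInstance
  refine (subsingleton_ext_one_iff_of_shortExact hS (ModuleCat.of R N)).trans ⟨?_, ?_⟩
  · intro hext f
    obtain ⟨h, hh⟩ := hext (ModuleCat.ofHom f)
    exact ⟨h.hom, congrArg ModuleCat.Hom.hom hh⟩
  · intro hext f
    obtain ⟨h, hh⟩ := hext f.hom
    exact ⟨ModuleCat.ofHom h, ModuleCat.hom_ext hh⟩

theorem extOneVanishes_iff_forall_ker_exists_comp_eq {P M : Type u}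
    [AddCommGroup P] [Module R P] [Module.Projective R P] [AddCommGroup M] [Module R M]
    {g : P →ₗ[R] M} (hg : Function.Surjective g) (N : Type u) [AddCommGroup N] [Module R N] :
    ExtOneVanishes R M N ↔
      ∀ f : LinearMap.ker g →ₗ[R] N, ∃ h : P →ₗ[R] N, h ∘ₗ (LinearMap.ker g).subtype = f :=
  extOneVanishes_iff_forall_exists_comp_eq (Submodule.injective_subtype _)
    (LinearMap.exact_subtype_ker_map g) hg N

end ExtOne

section Purity

variable {R : Type u} [CommRing R] {A B E : Type u} [AddCommGroup A] [Module R A]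
  [AddCommGroup B] [Module R B] [AddCommGroup E] [Module R E]

/-- `i : A → B` is a pure monomorphism: it stays injective after tensoring with any module.
(Tensoring with `R` shows that `i` itself is injective.) -/
def IsPure (i : A →ₗ[R] B) : Prop :=
  ∀ (M : Type u) [AddCommGroup M] [Module R M], Function.Injective (i.rTensor M)

theorem IsPure.of_comp {i : A →ₗ[R] B} {j : B →ₗ[R] E} (h : IsPure (j ∘ₗ i)) : IsPure i := by
  intro M _ _
  have hM := h M
  rw [LinearMap.rTensor_comp, LinearMap.coe_comp] at hM
  exact hM.of_comp

theorem isPure_subtype_range_iff {i : A →ₗ[R] B} (hi : Function.Injective i) :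
    IsPure (LinearMap.range i).subtype ↔ IsPure i := by
  let e := LinearEquiv.ofInjective i hi
  have he (M : Type u) [AddCommGroup M] [Module R M] :
      i.rTensor M = (LinearMap.range i).subtype.rTensor M ∘ₗ (e.rTensor M).toLinearMap :=
    LinearMap.rTensor_comp M (LinearMap.range i).subtype e.toLinearMap
  refine forall₃_congr fun M _ _ => ?_
  rw [he, LinearMap.coe_comp]
  exact (Function.Injective.of_comp_iff' _ (e.rTensor M).bijective).symm

theorem isPure_of_forall_fg_exists_leftInverse {i : A →ₗ[R] B}
    (h : ∀ N : Submodule R A, N.FG → ∃ ρ : B →ₗ[R] A, ∀ x ∈ N, ρ (i x) = x) : IsPure i := by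
  refine fun M _ _ => (injective_iff_map_eq_zero _).2 fun z hz => ?_
  obtain ⟨N, hN, hzN⟩ :=
    TensorProduct.exists_finite_submodule_left_of_setFinite {z} (Set.finite_singleton z)
  obtain ⟨z, rfl⟩ := hzN rfl
  obtain ⟨ρ, hρ⟩ := h N (Module.Finite.iff_fg.1 hN)
  have hρN : (ρ ∘ₗ i) ∘ₗ N.subtype = N.subtype := LinearMap.ext fun x => hρ x x.2
  have hρz := congrArg (ρ.rTensor M) hz
  rwa [map_zero, ← LinearMap.rTensor_comp_apply, ← LinearMap.rTensor_comp_apply, hρN] at hρz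

/-- Via `Hom(P, A) ≅ P* ⊗ A`, the maps `P → A` that factor through `T : P → F` form the kernel of
`P* ⊗ A → coker T* ⊗ A`, and purity of `i` makes `coker T* ⊗ A → coker T* ⊗ B` injective. -/
theorem IsPure.exists_comp_eq {i : A →ₗ[R] B} (hi : IsPure i) {P F : Type u}
    [AddCommGroup P] [Module R P] [Module.Finite R P] [Module.Projective R P]
    [AddCommGroup F] [Module R F] [Module.Finite R F] [Module.Projective R F]
    {T : P →ₗ[R] F} {f : P →ₗ[R] A} {h : F →ₗ[R] B} (hfh : h ∘ₗ T = i ∘ₗ f) :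
    ∃ h' : F →ₗ[R] A, h' ∘ₗ T = f := by
  let q := (LinearMap.range T.dualMap).mkQ
  have exact_q (N : Type u) [AddCommGroup N] [Module R N] :
      Function.Exact (T.dualMap.rTensor N) (q.rTensor N) :=
    rTensor_exact N (LinearMap.exact_map_mkQ_range T.dualMap) (Submodule.mkQ_surjective _)
  obtain ⟨z, rfl⟩ := (dualTensorHom_bijective (R := R) (M := P) (N := A)).2 f
  obtain ⟨y, rfl⟩ := (dualTensorHom_bijective (R := R) (M := F) (N := B)).2 h
  have hyz : T.dualMap.rTensor B y = i.lTensor _ z :=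
    (dualTensorHom_bijective (R := R) (M := P) (N := B)).1 <|
      (LinearMap.congr_fun (dualTensorHom_comp_rTensor_dualMap T) y).trans <|
        hfh.trans (LinearMap.congr_fun (dualTensorHom_comp_lTensor i) z).symm
  have hqz : q.rTensor A z = 0 := by
    refine (i.lTensor_inj_iff_rTensor_inj _).2 (hi _) ?_
    rw [map_zero, ← LinearMap.comp_apply, LinearMap.lTensor_comp_rTensor,
      ← LinearMap.rTensor_comp_lTensor, LinearMap.comp_apply, ← hyz]
    exact (exact_q B).apply_apply_eq_zero y
  obtain ⟨w, rfl⟩ := (exact_q A z).1 hqz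
  exact ⟨dualTensorHom R F A w,
    (LinearMap.congr_fun (dualTensorHom_comp_rTensor_dualMap T) w).symm⟩

variable (R A) in
/-- `A` is absolutely pure (FP-injective): it is pure in every module that contains it. -/
def IsAbsolutelyPure : Prop :=
  ∀ (B : Type u) [AddCommGroup B] [Module R B] (i : A →ₗ[R] B), Function.Injective i → IsPure i

theorem IsPure.isAbsolutelyPure [Module.Injective R E] {i : A →ₗ[R] E} (hi : IsPure i) :
    IsAbsolutelyPure R A := by
  intro B _ _ j hj
  obtain ⟨h, rfl⟩ := Module.Injective.extension_property R E A B j hj i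
  exact hi.of_comp

variable (R A) in
theorem exists_embedding_into_injective :
    ∃ (E : Type u) (_ : AddCommGroup E) (_ : Module R E) (i : A →ₗ[R] E),
      Module.Injective R E ∧ Function.Injective i := by
  obtain ⟨⟨E, _, i, hi⟩⟩ := EnoughInjectives.presentation (ModuleCat.of R A)
  exact ⟨E, inferInstance, inferInstance, i.hom,
    Module.injective_module_of_injective_object R E, (ModuleCat.mono_iff_injective i).1 hi⟩

theorem IsAbsolutelyPure.extOneVanishes (hA : IsAbsolutelyPure R A) (M : Type u) [AddCommGroup M]
    [Module R M] [Module.FinitePresentation R M] : ExtOneVanishes R M A := by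
  obtain ⟨n, m, g, T, hg, hTg⟩ := Module.FinitePresentation.exists_fin' R M
  refine (extOneVanishes_iff_forall_ker_exists_comp_eq hg A).2 fun f => ?_
  obtain ⟨E, _, _, i, _, hi⟩ := exists_embedding_into_injective R A
  obtain ⟨h, hh⟩ := Module.Injective.extension_property R E _ _ (LinearMap.ker g).subtype
    (Submodule.injective_subtype _) (i ∘ₗ f)
  let T' := T.codRestrict (LinearMap.ker g) hTg.apply_apply_eq_zero
  have hT' : Function.Surjective T' := fun ⟨x, hx⟩ =>
    ((hTg x).1 hx).imp fun _ hy => Subtype.ext hy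
  obtain ⟨h', hh'⟩ := (hA E i hi).exists_comp_eq (T := T) (f := f ∘ₗ T') (h := h)
    (congrArg (· ∘ₗ T') hh)
  exact ⟨h', LinearMap.cancel_right hT' |>.1 hh'⟩

end Purity

section EventuallyZero

variable {R : Type u} [CommRing R] {ι : Type u} (l : Filter ι) (E : ι → Type u)
  [∀ i, AddCommGroup (E i)] [∀ i, Module R (E i)]

variable (R) in
/-- The elements of `∏ E i` that vanish along the filter `l`, i.e. the kernel of the map to the
reduced product. It serves as a source of absolutely pure modules that need not be injective. -/
def eventuallyZero : Submodule R (∀ i, E i) where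
  carrier := {t | ∀ᶠ i in l, t i = 0}
  zero_mem' := .of_forall fun _ => rfl
  add_mem' {s t} hs ht := by
    filter_upwards [hs, ht] with i hsi hti
    rw [Pi.add_apply, hsi, hti, add_zero]
  smul_mem' c t ht := by
    filter_upwards [ht] with i hti
    rw [Pi.smul_apply, hti, smul_zero]

variable {l E}

theorem eventually_forall_mem_apply_eq_zero_of_fg {N : Submodule R (eventuallyZero R l E)}
    (hN : N.FG) : ∀ᶠ i in l, ∀ t ∈ N, t.1 i = 0 := by
  obtain ⟨s, rfl⟩ := hN
  have hs : ∀ᶠ i in l, ∀ t ∈ s, t.1 i = 0 := (Filter.eventually_all_finset s).2 fun t _ => t.2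
  filter_upwards [hs] with i hi t ht
  have hle : Submodule.span R (s : Set (eventuallyZero R l E)) ≤
      LinearMap.ker (LinearMap.proj i ∘ₗ (eventuallyZero R l E).subtype) :=
    Submodule.span_le.2 hi
  exact hle ht

theorem isPure_subtype_eventuallyZero : IsPure (eventuallyZero R l E).subtype := by
  classical
  refine isPure_of_forall_fg_exists_leftInverse fun N hN => ?_
  have hl := eventually_forall_mem_apply_eq_zero_of_fg hN
  let ρ : (∀ i, E i) →ₗ[R] ∀ i, E i :=
    LinearMap.pi fun i => if ∀ t ∈ N, t.1 i = 0 then 0 else LinearMap.proj i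
  refine ⟨ρ.codRestrict _ fun t => hl.mono fun i hi => ?_,
    fun t ht => Subtype.ext (funext fun i => ?_)⟩
  · simp only [ρ, LinearMap.pi_apply, if_pos hi, LinearMap.zero_apply]
  · change ρ t.1 i = t.1 i
    simp only [ρ, LinearMap.pi_apply]
    split_ifs with hi
    · exact (hi t ht).symm
    · rfl

theorem isAbsolutelyPure_eventuallyZero [∀ i, Module.Injective R (E i)] :
    IsAbsolutelyPure R (eventuallyZero R l E) :=
  isPure_subtype_eventuallyZero.isAbsolutelyPure

/-- Embed `K / span s` into an injective module for each finite `s ⊆ K`: the classes of an element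
of `K` vanish for large `s`, and once `K → eventuallyZero` extends to the finitely generated `F`,
they vanish for a single `s` and all elements of `K` at once. -/
theorem fg_of_forall_isAbsolutelyPure_exists_comp_eq {F : Type u} [AddCommGroup F] [Module R F]
    [Module.Finite R F] (K : Submodule R F)
    (hK : ∀ (A : Type u) [AddCommGroup A] [Module R A], IsAbsolutelyPure R A →
      ∀ f : K →ₗ[R] A, ∃ h : F →ₗ[R] A, h ∘ₗ K.subtype = f) : K.FG := by
  choose E _ _ i _ hi using fun s : Finset K =>
    exists_embedding_into_injective R (K ⧸ Submodule.span R (s : Set K))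
  let φ : K →ₗ[R] ∀ s, E s := LinearMap.pi fun s => i s ∘ₗ Submodule.mkQ _
  have φ_eq_zero_iff (x : K) (s : Finset K) :
      φ x s = 0 ↔ x ∈ Submodule.span R (s : Set K) :=
    (map_eq_zero_iff (i s) (hi s)).trans (Submodule.Quotient.mk_eq_zero _)
  have hφ (x : K) : φ x ∈ eventuallyZero R Filter.atTop E := by
    filter_upwards [Filter.eventually_ge_atTop {x}] with s hs
    exact (φ_eq_zero_iff x s).2 (Submodule.subset_span (hs (Finset.mem_singleton_self x)))
  obtain ⟨h, hh⟩ := hK _ isAbsolutelyPure_eventuallyZero (φ.codRestrict _ hφ)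
  obtain ⟨s, hs⟩ := (eventually_forall_mem_apply_eq_zero_of_fg
    (Module.Finite.iff_fg.1 (inferInstance : Module.Finite R (LinearMap.range h)))).exists
  refine Module.Finite.iff_fg.1 ⟨s, eq_top_iff.2 fun x _ => (φ_eq_zero_iff x s).1 ?_⟩
  rw [← hs (h x) ⟨x, rfl⟩]
  exact congrArg (fun t => t.1 s) (LinearMap.congr_fun hh x).symm

end EventuallyZero

section WPure

variable {R : Type u} [CommRing R] {A : Type u} [AddCommGroup A] [Module R A]

theorem isWPureSubmodule_iff {B : Type u} [AddCommGroup B] [Module R B] (A : Submodule R B) :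
    IsWPureSubmodule A ↔
      ∀ (M : Type u) [AddCommGroup M] [Module R M] (p : Ideal R) [p.IsPrime], IsMaximalWIdeal p →
        Function.Injective (LocalizedModule.map p.primeCompl (A.subtype.rTensor M)) := by
  refine ⟨fun h M _ _ p _ hp => (h.2 M p hp).1, fun h => ⟨fun p _ _ => ⟨?_, ?_, ?_⟩,
    fun M _ _ p _ hp => ⟨h M p hp, ?_, ?_⟩⟩⟩
  · exact LocalizedModule.map_injective _ _ A.injective_subtype
  · exact LocalizedModule.map_exact _ _ _ (LinearMap.exact_subtype_mkQ A)
  · exact LocalizedModule.map_surjective _ _ A.mkQ_surjective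
  · exact LocalizedModule.map_exact _ _ _
      (rTensor_exact M (LinearMap.exact_subtype_mkQ A) A.mkQ_surjective)
  · exact LocalizedModule.map_surjective _ _ (LinearMap.rTensor_surjective M A.mkQ_surjective)

theorem IsAbsolutelyPure.isAbsolutelyWPure (hA : IsAbsolutelyPure R A) :
    IsAbsolutelyWPure R A := fun B _ _ i hi =>
  (isWPureSubmodule_iff _).2 fun M _ _ _ _ _ =>
    LocalizedModule.map_injective _ _ ((isPure_subtype_range_iff hi).2 (hA B i hi) M)

theorem IsDWRing.isMaximalWIdeal (hR : IsDWRing R) (p : Ideal R) [hp : p.IsMaximal] :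
    IsMaximalWIdeal p :=
  ⟨⟨hp.ne_top, hR p⟩, fun _ hI hpI => (hp.eq_of_le hI.1 hpI).ge⟩

theorem IsDWRing.isAbsolutelyPure (hR : IsDWRing R) (hA : IsAbsolutelyWPure R A) :
    IsAbsolutelyPure R A := fun B _ _ i hi =>
  (isPure_subtype_range_iff hi).1 fun M _ _ => injective_of_localized_maximal _ fun p _ =>
    (isWPureSubmodule_iff _).1 (hA B i hi) M p (hR.isMaximalWIdeal p)

theorem IsMaximalWIdeal.not_isGVIdeal_le {p : Ideal R} (hp : IsMaximalWIdeal p) {J : Ideal R}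
    (hJ : IsGVIdeal J) : ¬ J ≤ p := fun hJp =>
  hp.prop.1 <| (Ideal.eq_top_iff_one p).2 <|
    (isWModule_ideal_iff p).1 hp.prop.2 J hJ 1 fun a ha => by simpa only [mul_one] using hJp ha

theorem IsGVIdeal.isAbsolutelyWPure {J : Ideal R} (hJ : IsGVIdeal J)
    (hA : Module.IsTorsionBySet R A J) : IsAbsolutelyWPure R A := fun B _ _ i _ =>
  (isWPureSubmodule_iff _).2 fun M _ _ p _ hp => by
    obtain ⟨s, hsJ, hsp⟩ := SetLike.not_le_iff_exists.1 (hp.not_isGVIdeal_le hJ)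
    have hs (z : LinearMap.range i ⊗[R] M) : s • z = 0 := by
      induction z with
      | zero => exact smul_zero s
      | add x y hx hy => rw [smul_add, hx, hy, add_zero]
      | tmul x y =>
        obtain ⟨_, a, rfl⟩ := x
        have hsa : s • (⟨i a, a, rfl⟩ : LinearMap.range i) = 0 :=
          Subtype.ext <| (map_smul i s a).symm.trans <|
            (congrArg i (@hA a ⟨s, hsJ⟩)).trans (map_zero i)
        rw [TensorProduct.smul_tmul', hsa, TensorProduct.zero_tmul]
    have : Subsingleton (LocalizedModule p.primeCompl (LinearMap.range i ⊗[R] M)) :=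
      LocalizedModule.subsingleton_iff.2 fun z => ⟨s, hsp, hs z⟩
    exact Function.injective_of_subsingleton _

end WPure

section Coherent

variable {R : Type u} [CommRing R]

theorem IsCoherent.finitePresentation_of_injective (hR : IsCoherent R) {n : ℕ} {N : Type*}
    [AddCommGroup N] [Module R N] [Module.Finite R N] {f : N →ₗ[R] (Fin n → R)}
    (hf : Function.Injective f) : Module.FinitePresentation R N := by
  induction n generalizing N with
  | zero =>
    have : Subsingleton N := hf.subsingleton
    infer_instance
  | succ n ih =>
    let g : N →ₗ[R] R := LinearMap.proj (Fin.last n) ∘ₗ f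
    have hg : Function.Surjective g.rangeRestrict := g.surjective_rangeRestrict
    have : Module.FinitePresentation R (LinearMap.range g) :=
      hR (LinearMap.range g) (Module.Finite.iff_fg.1 inferInstance)
    have : Module.Finite R (LinearMap.ker g.rangeRestrict) :=
      Module.Finite.iff_fg.2 (Module.FinitePresentation.fg_ker g.rangeRestrict hg)
    let f' : LinearMap.ker g.rangeRestrict →ₗ[R] (Fin n → R) :=
      LinearMap.funLeft R R Fin.castSucc ∘ₗ f ∘ₗ (LinearMap.ker g.rangeRestrict).subtype
    have hf' : Function.Injective f' := fun x y hxy => by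
      refine Subtype.ext (hf (funext (Fin.lastCases ?_ (congrFun hxy))))
      exact congrArg Subtype.val (x.2.trans y.2.symm)
    have := ih hf'
    exact Module.finitePresentation_of_ker g.rangeRestrict hg

theorem IsDWRing.isWFPProjective_of_finitePresentation (hR : IsDWRing R) (M : Type u)
    [AddCommGroup M] [Module R M] [Module.FinitePresentation R M] : IsWFPProjective R M :=
  fun _ _ _ hA => (hR.isAbsolutelyPure hA).extOneVanishes M

theorem IsWFPProjective.finitePresentation {M : Type u} [AddCommGroup M] [Module R M]
    [Module.Finite R M] (hM : IsWFPProjective R M) : Module.FinitePresentation R M := by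
  obtain ⟨n, g, hg⟩ := Module.Finite.exists_fin' R M
  refine Module.finitePresentation_of_surjective g hg ?_
  exact fg_of_forall_isAbsolutelyPure_exists_comp_eq _ fun A _ _ hA =>
    (extOneVanishes_iff_forall_ker_exists_comp_eq hg A).1 (hM A hA.isAbsolutelyWPure)

theorem isCoherent_of_forall_fg_isWFPProjective
    (h : ∀ I : Ideal R, I.FG → IsWFPProjective R I) : IsCoherent R := fun I hI =>
  have : Module.Finite R I := Module.Finite.iff_fg.2 hI
  (h I hI).finitePresentation

end Coherent

section PolynomialInEndomorphism

open Polynomial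

variable {R F M : Type*} [CommRing R] [AddCommGroup F] [Module R F] [AddCommGroup M] [Module R M]

theorem exists_eval_one_sub_one_mem_and_aeval_eq_zero [Module.Finite R M] {e : Module.End R M}
    {I : Ideal R} (he : LinearMap.range e ≤ I • ⊤) :
    ∃ p : R[X], p.eval 1 - 1 ∈ I ∧ aeval e p = 0 := by
  obtain ⟨p, hp, -, hpI, hp0⟩ :=
    LinearMap.exists_monic_and_natDegree_eq_and_coeff_mem_pow_and_aeval_eq_zero R e I he
  refine ⟨p, ?_, hp0⟩
  rw [eval_eq_sum_range, Finset.sum_range_succ, hp.coeff_natDegree, one_pow, mul_one,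
    add_sub_cancel_right]
  refine I.sum_mem fun k hk => ?_
  rw [one_pow, mul_one]
  exact Ideal.pow_le_self (Nat.sub_ne_zero_of_lt (Finset.mem_range.1 hk)) (hpI k)

theorem aeval_apply_apply_of_comp_eq {e : Module.End R F} {e' : Module.End R M} {g : F →ₗ[R] M}
    (h : e' ∘ₗ g = g ∘ₗ e) (p : R[X]) (x : F) : aeval e' p (g x) = g (aeval e p x) := by
  simp only [aeval_eq_sum_range, LinearMap.sum_apply, LinearMap.smul_apply, map_sum, map_smul]
  exact Finset.sum_congr rfl fun k _ => congrArg _ <|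
    LinearMap.congr_fun (Module.End.commute_pow_left_of_commute h k) x

end PolynomialInEndomorphism

section GVIdeal

open Polynomial

variable {R : Type u} [CommRing R]

theorem exists_comp_eq_smul_id_of_extOneVanishes {F M : Type u} [AddCommGroup F] [Module R F]
    [AddCommGroup M] [Module R M] [Module.Projective R F] {g : F →ₗ[R] M}
    (hg : Function.Surjective g) (hK : (LinearMap.ker g).FG) {I : Ideal R}
    (hM : ExtOneVanishes R M (LinearMap.ker g ⧸ (I • ⊤ : Submodule R (LinearMap.ker g)))) :
    ∃ r : R, r - 1 ∈ I ∧ ∃ s : M →ₗ[R] F, g ∘ₗ s = r • LinearMap.id := by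
  let K := LinearMap.ker g
  have : Module.Finite R K := Module.Finite.iff_fg.2 hK
  obtain ⟨h, hh⟩ := (extOneVanishes_iff_forall_ker_exists_comp_eq hg _).1 hM (Submodule.mkQ _)
  obtain ⟨φ, rfl⟩ := Module.projective_lifting_property _ h (Submodule.mkQ_surjective _)
  let e : Module.End R F := 1 - K.subtype ∘ₗ φ
  let eK : Module.End R K := 1 - φ ∘ₗ K.subtype
  have heK : LinearMap.range eK ≤ I • ⊤ := by
    rintro _ ⟨x, rfl⟩
    exact (Submodule.Quotient.eq _).1 (LinearMap.congr_fun hh x).symm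
  have hge : 1 ∘ₗ g = g ∘ₗ e := LinearMap.ext fun x =>
    ((map_sub g x (φ x)).trans ((congrArg (g x - ·) (φ x).2).trans (sub_zero _))).symm
  obtain ⟨p, hpI, hp⟩ := exists_eval_one_sub_one_mem_and_aeval_eq_zero heK
  have hpK : K ≤ LinearMap.ker (aeval e p) := fun x hx =>
    (aeval_apply_apply_of_comp_eq (g := K.subtype) (e := eK) rfl p ⟨x, hx⟩).trans <| by
      rw [hp, LinearMap.zero_apply, map_zero]
  let s : M →ₗ[R] F := K.liftQ (aeval e p) hpK ∘ₗ (g.quotKerEquivOfSurjective hg).symm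
  have hs (x : F) : s (g x) = aeval e p x :=
    congrArg (K.liftQ (aeval e p) hpK) ((LinearEquiv.symm_apply_eq _).2 rfl : _ = K.mkQ x)
  have aeval_one : aeval (1 : Module.End R M) p = p.eval 1 • LinearMap.id := by
    rw [← map_one (algebraMap R (Module.End R M)), aeval_algebraMap_apply_eq_algebraMap_eval]
    rfl
  refine ⟨p.eval 1, hpI, s, (LinearMap.cancel_right hg).1 (LinearMap.ext fun x => ?_)⟩
  calc g (s (g x)) = g (aeval e p x) := congrArg g (hs x)
    _ = aeval (1 : Module.End R M) p (g x) := (aeval_apply_apply_of_comp_eq hge p x).symm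
    _ = (p.eval 1 • LinearMap.id : Module.End R M) (g x) := LinearMap.congr_fun aeval_one (g x)

theorem IsGVIdeal.exists_forall_apply_eq_smul {J : Ideal R} (hJ : IsGVIdeal J) {ι : Type*}
    (s : J →ₗ[R] (ι → R)) : ∃ c : ι → R, ∀ x : J, s x = (x : R) • c := by
  choose c hc using fun i => hJ.2.2 (LinearMap.proj i ∘ₗ s)
  exact ⟨c, fun x => funext fun i =>
    (LinearMap.congr_fun (hc i) x).symm.trans (mul_comm (c i) (x : R))⟩

theorem IsGVIdeal.mem_of_comp_eq_smul_id {J : Ideal R} (hJ : IsGVIdeal J) {ι : Type*}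
    {g : (ι → R) →ₗ[R] J} {s : J →ₗ[R] (ι → R)} {r : R} (hgs : g ∘ₗ s = r • LinearMap.id) :
    r ∈ J := by
  obtain ⟨c, hc⟩ := hJ.exists_forall_apply_eq_smul s
  have hr : (g c : R) - r = 0 := hJ.eq_zero fun a ha => by
    have hgsa : g (a • c) = r • ⟨a, ha⟩ :=
      (congrArg g (hc ⟨a, ha⟩)).symm.trans (LinearMap.congr_fun hgs ⟨a, ha⟩)
    have hac : a * (g c : R) = r * a := congrArg Subtype.val ((map_smul g a c).symm.trans hgsa)
    rw [mul_sub, hac, mul_comm, sub_self]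
  rw [← sub_eq_zero.1 hr]
  exact (g c).2

theorem IsGVIdeal.eq_top_of_isWFPProjective {J : Ideal R} (hJ : IsGVIdeal J)
    (hJw : IsWFPProjective R J) : J = ⊤ := by
  have : Module.Finite R J := Module.Finite.iff_fg.2 hJ.1
  have := hJw.finitePresentation
  obtain ⟨n, g, hg⟩ := Module.Finite.exists_fin' R J
  have hK : Module.IsTorsionBySet R
      (LinearMap.ker g ⧸ (J • ⊤ : Submodule R (LinearMap.ker g))) J :=
    Module.isTorsionBySet_quotient_ideal_smul _ J
  obtain ⟨r, hr, s, hgs⟩ := exists_comp_eq_smul_id_of_extOneVanishes hg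
    (Module.FinitePresentation.fg_ker g hg) (hJw _ (hJ.isAbsolutelyWPure hK))
  rw [Ideal.eq_top_iff_one, ← sub_sub_cancel r 1]
  exact J.sub_mem (hJ.mem_of_comp_eq_smul_id hgs) hr

theorem isDWRing_of_forall_isGVIdeal_eq_top (h : ∀ J : Ideal R, IsGVIdeal J → J = ⊤) :
    IsDWRing R := fun I =>
  (isWModule_ideal_iff I).2 fun J hJ x hx => by
    simpa only [one_mul] using hx 1 (h J hJ ▸ Submodule.mem_top)

end GVIdeal

section TorsionFree

theorem exists_smul_eq_algebraMap {R : Type*} [CommRing R] {K : Type*} [CommRing K] [Algebra R K]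
    [IsFractionRing R K] {M : Type*} [AddCommGroup M] [Module R M] [Module.Finite R M]
    (φ : M →ₗ[R] K) :
    ∃ c ∈ nonZeroDivisors R, ∃ g : M →ₗ[R] R, ∀ x, algebraMap R K (g x) = c • φ x := by
  obtain ⟨c, hc, hcφ⟩ := FractionalIdeal.isFractional_of_fg (S := nonZeroDivisors R)
    (I := LinearMap.range φ) (Module.Finite.iff_fg.1 inferInstance)
  let e := LinearEquiv.ofInjective (Algebra.linearMap R K) (IsFractionRing.injective R K)
  let φ' := (c • φ).codRestrict (LinearMap.range (Algebra.linearMap R K)) fun x =>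
    hcφ (φ x) ⟨x, rfl⟩
  exact ⟨c, hc, e.symm.toLinearMap ∘ₗ φ', fun x =>
    congrArg Subtype.val (e.apply_symm_apply (φ' x))⟩

theorem exists_injective_to_pi_of_isTorsionFree (R : Type*) [CommRing R] [IsDomain R] (M : Type*)
    [AddCommGroup M] [Module R M] [Module.Finite R M] [Module.IsTorsionFree R M] :
    ∃ (n : ℕ) (f : M →ₗ[R] (Fin n → R)), Function.Injective f := by
  let K := FractionRing R
  let ι := LocalizedModule.mkLinearMap (nonZeroDivisors R) M
  have hι : Function.Injective ι := (injective_iff_map_eq_zero ι).2 fun x hx => by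
    obtain ⟨s, hs⟩ := (IsLocalizedModule.eq_zero_iff (nonZeroDivisors R) ι).1 hx
    exact (smul_eq_zero_iff_right (nonZeroDivisors.coe_ne_zero s)).1 hs
  have : Module.Finite K (LocalizedModule (nonZeroDivisors R) M) :=
    Module.Finite.of_isLocalizedModule (nonZeroDivisors R) ι
  let b := Module.finBasis K (LocalizedModule (nonZeroDivisors R) M)
  choose c hc g hg using fun j =>
    exists_smul_eq_algebraMap ((b.coord j).restrictScalars R ∘ₗ ι)
  refine ⟨_, LinearMap.pi g, (injective_iff_map_eq_zero _).2 fun x hx => ?_⟩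
  refine (map_eq_zero_iff ι hι).1 (b.forall_coord_eq_zero_iff.1 fun j => ?_)
  refine (smul_eq_zero_iff_right (nonZeroDivisors.ne_zero (hc j))).1 ((hg j x).symm.trans ?_)
  rw [show g j x = 0 from congrFun hx j, map_zero]

end TorsionFree

end WFP

theorem mainTheorem6_general (R : Type u) [CommRing R] :
    (WFP.IsCoherent R ∧ WFP.IsDWRing R) ↔
      ∀ (M : Type u) [AddCommGroup M] [Module R M], Module.Finite R M →
        (∃ (n : ℕ) (f : M →ₗ[R] (Fin n → R)), Function.Injective f) →
          WFP.IsWFPProjective R M := by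
  constructor
  · rintro ⟨hcoh, hdw⟩ M _ _ _ ⟨n, f, hf⟩
    have := hcoh.finitePresentation_of_injective hf
    exact hdw.isWFPProjective_of_finitePresentation M
  · intro h
    have hideal : ∀ I : Ideal R, I.FG → WFP.IsWFPProjective R I := fun I hI =>
      h I (Module.Finite.iff_fg.2 hI) ⟨1, LinearMap.pi fun _ => I.subtype, fun _ _ hxy =>
        Subtype.ext (congrFun hxy 0)⟩
    exact ⟨WFP.isCoherent_of_forall_fg_isWFPProjective hideal,
      WFP.isDWRing_of_forall_isGVIdeal_eq_top fun J hJ =>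
        hJ.eq_top_of_isWFPProjective (hideal J hJ.1)⟩

theorem mainTheorem6 (R : Type u) [CommRing R] [IsDomain R] :
    (WFP.IsCoherent R ∧ WFP.IsDWRing R) ↔
      ∀ (M : Type u) [AddCommGroup M] [Module R M], Module.Finite R M →
        Module.IsTorsionFree R M → WFP.IsWFPProjective R M := by
  refine (mainTheorem6_general R).trans
    ⟨fun h M _ _ hM _ => ?_, fun h M _ _ hM ⟨n, f, hf⟩ => ?_⟩
  · exact h M hM (WFP.exists_injective_to_pi_of_isTorsionFree R M)
  · exact h M hM (hf.moduleIsTorsionFree f (map_smul f))
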